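/- Let $q,p,k,n$ be nonnegative integers and $\sigma_\epsilon>0$. For $i=1,\dots,q$ let $\phi_i(z)=\sqrt2\cos(i\pi z)$, and let \[ \mathcal G_{2k+1}=\Big\{g_{\mathcal A}(\boldsymbol x)=\prod_{(i,j)\in\mathcal A}\phi_i(x_j)\;:\;\mathcal A\subseteq\{1,\dots,q\}\times\{1,\dots,p\},\ |\mathcal A|\le k+1,\ \forall (i,j)\in\mathcal A,\ l\ne i\Rightarrow (l,j)\notin\mathcal A\Big\}. \] Nature picks a true function $\bar g$ uniformly at random from $\mathcal G_{2k+1}$. Given $\bar g$, let $\mathcal D$ be the distribution of $(\boldsymbol x,y)$ with $y=\bar g(\boldsymbol x)+\epsilon$, where $\boldsymbol x\sim\mathrm{Unif}[-1,1]^p$ and $\epsilon\sim N(0,\sigma_\epsilon^2)$ are independent, and let $S=\{(\boldsymbol x_i,y_i)\}_{i=1}^n$ be $n$ i.i.d. samples from $\mathcal D$. For $g\in\mathcal G_{2k+1}$ let $h(\boldsymbol x,y)=\frac12(y-g(\boldsymbol x))^2$ be the corresponding hypothesis, and let $\bar h$ correspond to $\bar g$. Let $\hat g$ be any estimator with values in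 $\mathcal G_{2k+1}$, that is, any measurable function of $S$ and possibly of a random seed independent of $(\bar g,S)$, and let $\hat h(\boldsymbol x,y)=\frac12(y-\hat g(\boldsymbol x))^2$. If \[ n\le\Big(\log\Big(q^{k+1}\binom{p}{k+1}\Big)-2\log 2\Big)\frac{\sigma_\epsilon^2}{2} \] (with $\log 0=-\infty$), then, with probability at least $\frac12$ over $\bar g$, $S$ and the seed, \[ \mathbb E_{\mathcal D}[\hat h]-\mathbb E_{\mathcal D}[\bar h]\ge 1, \] where all these risks are finite and $\mathbb E_{\mathcal D}$ is over a fresh pair $(\boldsymbol x,y)\sim\mathcal D$, independent of $S$ and of the seed. -/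

import Mathlib

open MeasureTheory ProbabilityTheory
open scoped NNReal ENNReal

noncomputable section

namespace TreeEnsemble

/-- The basis functions `φ_l(z) = √2 cos(l π z)`, used for `l = 1, …, q`. -/
def basisFn (l : ℕ) (z : ℝ) : ℝ := Real.sqrt 2 * Real.cos (l * Real.pi * z)

/-- The product function `g_A(x) = ∏_{(i,j) ∈ A} φ_i(x_j)`. The elements `0, …, q - 1` of `Fin q`
stand for the labels `1, …, q`. -/
def prodFn {q p : ℕ} (A : Finset (Fin q × Fin p)) (x : Fin p → ℝ) : ℝ :=
  ∏ a ∈ A, basisFn ((a.1 : ℕ) + 1) (x a.2)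

/-- `A` has at most `k + 1` elements and uses each covariate at most once. -/
def Admissible {q p : ℕ} (k : ℕ) (A : Finset (Fin q × Fin p)) : Prop :=
  A.card ≤ k + 1 ∧ ∀ a ∈ A, ∀ l : Fin q, l ≠ a.1 → (l, a.2) ∉ A

/-- The restricted ensemble `𝒢_{2k+1}`, as a set of functions on `ℝ^p`. -/
def ensemble (q p k : ℕ) : Set ((Fin p → ℝ) → ℝ) :=
  {g | ∃ A : Finset (Fin q × Fin p), Admissible k A ∧ g = prodFn A}

theorem ensemble_finite (q p k : ℕ) : (ensemble q p k).Finite := by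
  refine (Set.finite_range (fun A : Finset (Fin q × Fin p) => prodFn A)).subset ?_
  rintro g ⟨A, -, rfl⟩
  exact ⟨A, rfl⟩

theorem ensemble_nonempty (q p k : ℕ) : (ensemble q p k).Nonempty :=
  ⟨prodFn ∅, ∅, ⟨by simp, by simp⟩, rfl⟩

/-- The ensemble as a finite type, with the discrete measurable structure. -/
def Ensemble (q p k : ℕ) : Type := {g : (Fin p → ℝ) → ℝ // g ∈ ensemble q p k}

instance (q p k : ℕ) : Fintype (Ensemble q p k) := (ensemble_finite q p k).fintype

instance (q p k : ℕ) : Nonempty (Ensemble q p k) := (ensemble_nonempty q p k).to_subtype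

instance (q p k : ℕ) : MeasurableSpace (Ensemble q p k) := ⊤

/-- The function on `ℝ^p` underlying an element of the ensemble. -/
def Ensemble.fn {q p k : ℕ} (g : Ensemble q p k) : (Fin p → ℝ) → ℝ := g.1

/-- The uniform distribution on `[-1,1]^p`. -/
def unifCube (p : ℕ) : Measure (Fin p → ℝ) :=
  Measure.pi fun _ => cond (volume : Measure ℝ) (Set.Icc (-1) 1)

/-- The law of a covariate vector and an independent noise variable,
`(x, ε) ∼ Unif[-1,1]^p ⊗ N(0, σ²)`. -/
def covariateNoise (p : ℕ) (σ : ℝ≥0) : Measure ((Fin p → ℝ) × ℝ) :=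
  (unifCube p).prod (gaussianReal 0 (σ ^ 2))

/-- The observation `(x, y)` with `y = g(x) + ε` obtained from `(x, ε)`. -/
def observe {p : ℕ} (g : (Fin p → ℝ) → ℝ) (w : (Fin p → ℝ) × ℝ) : (Fin p → ℝ) × ℝ :=
  (w.1, g w.1 + w.2)

/-- The data distribution `𝒟` of `(x, y)` when the true function is `g`. -/
def dataLaw {p : ℕ} (σ : ℝ≥0) (g : (Fin p → ℝ) → ℝ) : Measure ((Fin p → ℝ) × ℝ) :=
  (covariateNoise p σ).map (observe g)

/-- The squared loss `h(x, y) = ½ (y - g(x))²` of the predictor `g`. -/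
def loss {p : ℕ} (g : (Fin p → ℝ) → ℝ) (z : (Fin p → ℝ) × ℝ) : ℝ :=
  (1 / 2) * (z.2 - g z.1) ^ 2

/-- The true risk `𝔼_𝒟[h]` of the predictor `g` when the true function is `gbar`. -/
def risk {p : ℕ} (σ : ℝ≥0) (gbar g : (Fin p → ℝ) → ℝ) : ℝ :=
  ∫ z, loss g z ∂(dataLaw σ gbar)

/-- The joint law of all the randomness: the true function, uniform on the ensemble, the `n`
independent pairs `(x_i, ε_i)`, and an independent random seed with law `ν`, on which a randomized
estimator may draw. -/
def experiment (q p k n : ℕ) (σ : ℝ≥0) {U : Type*} [MeasurableSpace U] (ν : Measure U) :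
    Measure (Ensemble q p k × (Fin n → (Fin p → ℝ) × ℝ) × U) :=
  (PMF.uniformOfFintype (Ensemble q p k)).toMeasure.prod
    ((Measure.pi fun _ => covariateNoise p σ).prod ν)

/-- The sample `(x_i, y_i)`, `y_i = g(x_i) + ε_i`, `i = 1, …, n`. -/
def sample {p n : ℕ} (g : (Fin p → ℝ) → ℝ) (w : Fin n → (Fin p → ℝ) × ℝ) :
    Fin n → (Fin p → ℝ) × ℝ :=
  fun i => observe g (w i)

end TreeEnsemble

end

/-! The functions of the ensemble are orthonormal in L² of the uniform law on the cube: each is a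
product of cosine-basis elements, one per covariate, and two different index sets use different
frequencies at some covariate. A wrong guess therefore has excess risk ‖ḡ - g‖² / 2 = 1 exactly, and
the claim becomes a lower bound on the probability of misidentifying `gbar`.

That bound is Fano's inequality with pure noise, y = ε, as reference law. Each function has unit
norm, so a sample of size n has divergence n / (2σ²) from the reference; an independent seed adds
nothing. With N functions in the ensemble, the average probability of recovery, times log N, is at
most n / (2σ²) + log 2 (`sum_measureReal_mul_log_card_le`). Orthonormality makes distinct admissible
sets give distinct functions, so N ≥ q^(k+1) * (p choose k+1) (`le_card_ensemble`), and the assumed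
bound on n makes the average at most 1/2. -/

noncomputable section

namespace TreeEnsemble

/-! ### Change of measure between signal and pure noise -/

/-- The Gaussian shift `ε ↦ a + ε` carries the exponentially tilted centred Gaussian to the
centred Gaussian. -/
theorem lintegral_gaussianReal_add_mul_exp {v : ℝ≥0} (hv : v ≠ 0) (a : ℝ) {f : ℝ → ℝ≥0∞}
    (hf : Measurable f) :
    ∫⁻ e, f (a + e) * ENNReal.ofReal (Real.exp (-((e * a + a ^ 2 / 2) / v)))
      ∂(gaussianReal 0 v) = ∫⁻ e, f e ∂(gaussianReal 0 v) := by
  have hv' : (v : ℝ) ≠ 0 := by exact_mod_cast hv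
  rw [gaussianReal_of_var_ne_zero _ hv,
    lintegral_withDensity_eq_lintegral_mul _ (measurable_gaussianPDF 0 v) (by fun_prop),
    lintegral_withDensity_eq_lintegral_mul _ (measurable_gaussianPDF 0 v) hf,
    ← lintegral_add_left_eq_self (gaussianPDF 0 v * f) a]
  refine lintegral_congr fun e => ?_
  -- Completing the square: e² / 2 + e a + a² / 2 = (a + e)² / 2.
  have key : gaussianPDF 0 v e * ENNReal.ofReal (Real.exp (-((e * a + a ^ 2 / 2) / v)))
      = gaussianPDF 0 v (a + e) := by
    rw [gaussianPDF, gaussianPDF, ← ENNReal.ofReal_mul (gaussianPDFReal_nonneg _ _ _),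
      gaussianPDFReal, gaussianPDFReal, mul_assoc, ← Real.exp_add]
    congr 3
    field_simp
    ring
  simp only [Pi.mul_apply]
  rw [← key]
  ring

/-- Densities of product form commute with finite products of probability measures. -/
theorem pi_withDensity_prod {ι α : Type*} [Fintype ι] [MeasurableSpace α] (μ : Measure α)
    [IsProbabilityMeasure μ] {f : α → ℝ≥0∞} (hf : Measurable f)
    [SigmaFinite (μ.withDensity f)] :
    Measure.pi (fun _ : ι => μ.withDensity f)
      = (Measure.pi fun _ : ι => μ).withDensity fun w => ∏ i, f (w i) := by
  refine Measure.pi_eq (μ := fun _ : ι => μ.withDensity f) fun s hs => ?_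
  rw [withDensity_apply _ (MeasurableSet.univ_pi hs),
    ← lintegral_indicator (MeasurableSet.univ_pi hs)]
  have h1 : ∀ w : ι → α, (Set.univ.pi s).indicator (fun w => ∏ i, f (w i)) w
      = ∏ i, (s i).indicator f (w i) := by
    intro w
    by_cases hw : w ∈ Set.univ.pi s
    · rw [Set.indicator_of_mem hw]
      exact Finset.prod_congr rfl fun i _ => (Set.indicator_of_mem (hw i trivial) f).symm
    · rw [Set.indicator_of_notMem hw]
      obtain ⟨i, hi⟩ : ∃ i, w i ∉ s i := by simpa [Set.mem_pi] using hw
      exact (Finset.prod_eq_zero (Finset.mem_univ i) (Set.indicator_of_notMem hi f)).symm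
  simp_rw [h1]
  have hm : ∀ i, Measurable ((s i).indicator f) := fun i => hf.indicator (hs i)
  have hind : iIndepFun (fun i (w : ι → α) => (s i).indicator f (w i))
      (Measure.pi fun _ : ι => μ) :=
    iIndepFun_pi (X := fun i => (s i).indicator f) fun i => (hm i).aemeasurable
  refine (lintegral_prod_eq_prod_lintegral_of_indepFun Finset.univ
    (fun i (w : ι → α) => (s i).indicator f (w i)) hind
    fun i => (hm i).comp (measurable_pi_apply i)).trans ?_
  refine Finset.prod_congr rfl fun i _ => ?_
  rw [(measurePreserving_eval (fun _ : ι => μ) i).lintegral_comp (hm i),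
    lintegral_indicator (hs i), withDensity_apply _ (hs i)]

instance (p : ℕ) : IsProbabilityMeasure (unifCube p) := by
  have : IsProbabilityMeasure (cond (volume : Measure ℝ) (Set.Icc (-1) 1)) :=
    cond_isProbabilityMeasure_of_finite (by simp) (by simp)
  unfold unifCube
  infer_instance

instance (p : ℕ) (σ : ℝ≥0) : IsProbabilityMeasure (covariateNoise p σ) := by
  unfold covariateNoise
  infer_instance

theorem measurable_observe {p : ℕ} {g : (Fin p → ℝ) → ℝ} (hg : Measurable g) :
    Measurable (observe g) := by
  unfold observe
  fun_prop

theorem measurable_sample {p n : ℕ} {g : (Fin p → ℝ) → ℝ} (hg : Measurable g) :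
    Measurable (sample (n := n) g) :=
  measurable_pi_lambda _ fun i => (measurable_observe hg).comp (measurable_pi_apply i)

/-- The log-likelihood ratio of `y = g(x) + ε` against pure noise, at one observation. -/
def logRatio {p : ℕ} (σ : ℝ≥0) (g : (Fin p → ℝ) → ℝ) (w : (Fin p → ℝ) × ℝ) : ℝ :=
  (w.2 * g w.1 + g w.1 ^ 2 / 2) / (σ ^ 2 : ℝ≥0)

theorem measurable_logRatio {p : ℕ} (σ : ℝ≥0) {g : (Fin p → ℝ) → ℝ} (hg : Measurable g) :
    Measurable (logRatio σ g) := by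
  unfold logRatio
  fun_prop

/-- For fixed x, adding g(x) to the noise is a Gaussian shift; Fubini then integrates over x. -/
theorem measurePreserving_observe {p : ℕ} {σ : ℝ≥0} (hσ : 0 < σ) {g : (Fin p → ℝ) → ℝ}
    (hg : Measurable g) :
    MeasurePreserving (observe g)
      ((covariateNoise p σ).withDensity fun w => ENNReal.ofReal (Real.exp (-logRatio σ g w)))
      (covariateNoise p σ) := by
  have hl := measurable_logRatio σ hg
  have ho := measurable_observe hg
  refine ⟨ho, Measure.ext_of_lintegral _ fun f hf => ?_⟩
  rw [lintegral_map hf ho, lintegral_withDensity_eq_lintegral_mul _ (by fun_prop)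
      (show Measurable fun w => f (observe g w) from hf.comp ho),
    covariateNoise, lintegral_prod _ (by fun_prop), lintegral_prod _ (by fun_prop)]
  refine lintegral_congr fun x => ?_
  rw [← lintegral_gaussianReal_add_mul_exp (pow_ne_zero 2 hσ.ne') (g x)
    (f := fun e => f (x, e)) (by fun_prop)]
  refine lintegral_congr fun e => ?_
  simp only [Pi.mul_apply, observe, logRatio]
  rw [mul_comm]

/-- A density-preserving map acts coordinatewise on samples, with the product density; an
independent seed is left alone. -/
theorem measurePreserving_pi_prodMk {ι α U : Type*} [Fintype ι] [MeasurableSpace α]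
    [MeasurableSpace U] {μ : Measure α} [IsProbabilityMeasure μ] (ν : Measure U)
    [IsProbabilityMeasure ν] {f : α → ℝ≥0∞} (hf : Measurable f) {T : α → α}
    (hT : MeasurePreserving T (μ.withDensity f) μ) :
    MeasurePreserving (fun w : (ι → α) × U => ((fun i => T (w.1 i)), w.2))
      (((Measure.pi fun _ => μ).prod ν).withDensity fun w => ∏ i, f (w.1 i))
      ((Measure.pi fun _ => μ).prod ν) := by
  have hp : IsProbabilityMeasure (μ.withDensity f) :=
    ⟨by simpa using hT.measure_preimage MeasurableSet.univ.nullMeasurableSet⟩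
  have h := (measurePreserving_pi (fun _ : ι => μ.withDensity f) (fun _ => μ)
    (fun _ => hT)).prod (MeasurePreserving.id ν)
  rw [pi_withDensity_prod _ hf, prod_withDensity_left (by fun_prop)] at h
  exact h

theorem measurePreserving_sample {p : ℕ} (n : ℕ) {σ : ℝ≥0} (hσ : 0 < σ)
    {g : (Fin p → ℝ) → ℝ} (hg : Measurable g) {U : Type*} [MeasurableSpace U] (ν : Measure U)
    [IsProbabilityMeasure ν] :
    MeasurePreserving (fun w : (Fin n → (Fin p → ℝ) × ℝ) × U => (sample g w.1, w.2))
      (((Measure.pi fun _ => covariateNoise p σ).prod ν).withDensity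
        fun w => ENNReal.ofReal (Real.exp (-∑ i, logRatio σ g (w.1 i))))
      ((Measure.pi fun _ => covariateNoise p σ).prod ν) := by
  have hl := measurable_logRatio σ hg
  have h := measurePreserving_pi_prodMk (ι := Fin n) ν (by fun_prop)
    (measurePreserving_observe hσ hg)
  convert! h using 3 with w
  rw [← Finset.sum_neg_distrib, Real.exp_sum, ENNReal.ofReal_prod_of_nonneg]
  exact fun _ _ => (Real.exp_pos _).le

/-! ### Fano's inequality -/

/-- The line is tangent to exp / 2 at t = log 2. This point of tangency produces the constant log 2
in Fano's inequality. -/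
theorem le_log_two_sub_one_add_exp (t : ℝ) : t ≤ Real.log 2 - 1 + Real.exp t / 2 := by
  have h := Real.add_one_le_exp (t - Real.log 2)
  rw [Real.exp_sub, Real.exp_log two_pos] at h
  linarith

/-- The change-of-measure inequality behind Fano's lemma: the probability of an event `T ∈ B` is
controlled by the divergence `∫ ℓ` and by the probability of `B` under the reference law `Q`. -/
theorem log_mul_measureReal_preimage_le {Ω Z : Type*} [MeasurableSpace Ω] [MeasurableSpace Z]
    {P : Measure Ω} {Q : Measure Z} [IsProbabilityMeasure P] [IsProbabilityMeasure Q]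
    {T : Ω → Z} {l : Ω → ℝ} (hT : Measurable T) (hl : Measurable l) (hli : Integrable l P)
    (hTQ : MeasurePreserving T (P.withDensity fun w => ENNReal.ofReal (Real.exp (-l w))) Q)
    {B : Set Z} (hB : MeasurableSet B) {c : ℝ} (hc : 0 < c) :
    Real.log c * P.real (T ⁻¹' B)
      ≤ ∫ w, l w ∂P + (Real.log 2 - 1) + (1 + (c - 1) * Q.real B) / 2 := by
  -- F is the exponential of log c times the indicator of B. The tangent bound is used at t = log c
  -- * 1_B(T w) - l w, and the tilt by exp(-l) turns the integral of the exponential term into the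
  -- integral of F under Q.
  set F : Z → ℝ := fun z => 1 + B.indicator (fun _ => c - 1) z with hF
  have hFi : Integrable F Q := (integrable_const 1).add ((integrable_const _).indicator hB)
  have hFint : ∫ z, F z ∂Q = 1 + (c - 1) * Q.real B := by
    rw [hF, integral_add (integrable_const 1) ((integrable_const _).indicator hB),
      integral_indicator hB]
    simp [mul_comm]
  have hdm : Measurable fun w => ENNReal.ofReal (Real.exp (-l w)) := by fun_prop
  have hEi : Integrable (fun w => Real.exp (-l w) * F (T w)) P := by
    have h := hTQ.integrable_comp_of_integrable hFi
    rw [integrable_withDensity_iff_integrable_smul' hdm (by simp)] at h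
    refine h.congr (ae_of_all _ fun w => ?_)
    simp [ENNReal.toReal_ofReal (Real.exp_pos _).le]
  have hEint : ∫ w, Real.exp (-l w) * F (T w) ∂P = 1 + (c - 1) * Q.real B := by
    rw [← hFint, ← hTQ.map_eq, integral_map hTQ.measurable.aemeasurable
      (by rw [hTQ.map_eq]; exact hFi.aestronglyMeasurable),
      integral_withDensity_eq_integral_toReal_smul hdm (by simp)]
    refine integral_congr_ae (ae_of_all _ fun w => ?_)
    simp [ENNReal.toReal_ofReal (Real.exp_pos _).le]
  have hpt : ∀ w, (T ⁻¹' B).indicator (fun _ => Real.log c) w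
      ≤ l w + (Real.log 2 - 1) + Real.exp (-l w) * F (T w) / 2 := by
    intro w
    by_cases hw : T w ∈ B
    · have h := le_log_two_sub_one_add_exp (Real.log c - l w)
      rw [sub_eq_add_neg, Real.exp_add, Real.exp_log hc] at h
      rw [Set.indicator_of_mem (show w ∈ T ⁻¹' B from hw), hF]
      simp only [Set.indicator_of_mem hw]
      linarith
    · have h := le_log_two_sub_one_add_exp (- l w)
      rw [Set.indicator_of_notMem (show w ∉ T ⁻¹' B from hw), hF]
      simp only [Set.indicator_of_notMem hw]
      linarith
  have hli' : Integrable (fun w => l w + (Real.log 2 - 1)) P := hli.add (integrable_const _)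
  have hi := integral_mono ((integrable_const (Real.log c)).indicator (hT hB))
    (hli'.add (hEi.div_const 2)) hpt
  rw [integral_indicator (hT hB)] at hi
  have hsum : ∫ w, (l w + (Real.log 2 - 1) + Real.exp (-l w) * F (T w) / 2) ∂P
      = ∫ w, l w ∂P + (Real.log 2 - 1) + (1 + (c - 1) * Q.real B) / 2 := by
    rw [integral_add hli' (hEi.div_const 2),
      integral_add hli (integrable_const _), integral_div, hEint]
    simp
  have hi' : P.real (T ⁻¹' B) * Real.log c
      ≤ ∫ w, (l w + (Real.log 2 - 1) + Real.exp (-l w) * F (T w) / 2) ∂P := by simpa using hi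
  linarith

/-- **Fano's inequality** with a reference law, for a uniformly distributed parameter. -/
theorem sum_measureReal_mul_log_card_le {G Ω Z : Type*} [Fintype G] [Nonempty G]
    [MeasurableSpace G] [MeasurableSingletonClass G] [MeasurableSpace Ω] [MeasurableSpace Z]
    {P : Measure Ω} {Q : Measure Z} [IsProbabilityMeasure P] [IsProbabilityMeasure Q]
    {T : G → Ω → Z} {l : G → Ω → ℝ} {K : ℝ} (hT : ∀ g, Measurable (T g))
    (hl : ∀ g, Measurable (l g)) (hli : ∀ g, Integrable (l g) P) (hK : ∀ g, ∫ w, l g w ∂P ≤ K)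
    (hTQ : ∀ g, MeasurePreserving (T g)
      (P.withDensity fun w => ENNReal.ofReal (Real.exp (-l g w))) Q)
    {est : Z → G} (hest : Measurable est) :
    (∑ g, P.real {w | est (T g w) = g}) * Real.log (Fintype.card G : ℝ)
      ≤ (Fintype.card G : ℝ) * (K + Real.log 2) := by
  set N : ℝ := (Fintype.card G : ℝ) with hN
  have hN0 : 0 < N := Nat.cast_pos.mpr Fintype.card_pos
  have h1 : ∀ g ∈ Finset.univ, Real.log N * P.real {w | est (T g w) = g}
      ≤ K + (Real.log 2 - 1) + (1 + (N - 1) * Q.real (est ⁻¹' {g})) / 2 := fun g _ => by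
    have h := log_mul_measureReal_preimage_le (hT g) (hl g) (hli g) (hTQ g)
      (hest (measurableSet_singleton g)) hN0
    have hset : T g ⁻¹' (est ⁻¹' {g}) = {w | est (T g w) = g} := rfl
    rw [hset] at h
    linarith [hK g]
  -- Under the reference law the estimator ignores g, so the events `est = g` partition the space.
  have hQ : ∑ g, Q.real (est ⁻¹' {g}) = 1 := by
    rw [sum_measureReal_preimage_singleton _ fun g _ => hest (measurableSet_singleton g)]
    simp
  have h2 := Finset.sum_le_sum h1
  rw [← Finset.mul_sum] at h2
  have h3 : ∑ g : G, (K + (Real.log 2 - 1) + (1 + (N - 1) * Q.real (est ⁻¹' {g})) / 2)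
      = N * (K + (Real.log 2 - 1) + 1 / 2) + (N - 1) / 2 := by
    simp_rw [add_div, Finset.sum_add_distrib, ← Finset.sum_div, ← Finset.mul_sum, hQ]
    simp [← hN]
    ring
  -- The right side equals N (K + log 2) - 1/2; the term -1/2 is dropped.
  rw [h3] at h2
  linarith

/-! ### Orthonormality of the ensemble -/

theorem integral_cond_Icc (f : ℝ → ℝ) :
    ∫ z, f z ∂(cond (volume : Measure ℝ) (Set.Icc (-1) 1)) = (∫ z in (-1)..1, f z) / 2 := by
  rw [ProbabilityTheory.cond, integral_smul_measure, intervalIntegral.integral_of_le (by norm_num),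
    integral_Icc_eq_integral_Ioc, Real.volume_Icc]
  norm_num
  ring

theorem integral_cos_int_mul_pi (m : ℤ) :
    ∫ z in (-1 : ℝ)..1, Real.cos (m * Real.pi * z) = if m = 0 then 2 else 0 := by
  split_ifs with hm
  · subst hm
    norm_num
  · have hc : (m : ℝ) * Real.pi ≠ 0 := mul_ne_zero (Int.cast_ne_zero.2 hm) Real.pi_ne_zero
    rw [intervalIntegral.integral_comp_mul_left (fun z => Real.cos z) hc]
    simp [Real.sin_int_mul_pi]

/-- The cosine basis, with the constant function as its element of index zero. -/
def cosBasis (m : ℕ) (z : ℝ) : ℝ := if m = 0 then 1 else basisFn m z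

theorem cosBasis_eq (m : ℕ) (z : ℝ) :
    cosBasis m z = (if m = 0 then 1 else √2) * Real.cos (m * Real.pi * z) := by
  unfold cosBasis basisFn
  split_ifs with h
  · simp [h]
  · rfl

theorem integral_cosBasis_mul (a b : ℕ) :
    ∫ z, cosBasis a z * cosBasis b z ∂(cond (volume : Measure ℝ) (Set.Icc (-1) 1))
      = if a = b then 1 else 0 := by
  have h : ∀ z, cosBasis a z * cosBasis b z
      = ((if a = 0 then 1 else √2) * (if b = 0 then 1 else √2) / 2) *
        (Real.cos (((a - b : ℤ) : ℝ) * Real.pi * z)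
          + Real.cos (((a + b : ℤ) : ℝ) * Real.pi * z)) := by
    intro z
    rw [cosBasis_eq, cosBasis_eq]
    push_cast
    rw [show ((a : ℝ) - b) * Real.pi * z = a * Real.pi * z - b * Real.pi * z by ring,
      show ((a : ℝ) + b) * Real.pi * z = a * Real.pi * z + b * Real.pi * z by ring,
      Real.cos_sub, Real.cos_add]
    ring
  simp_rw [h]
  rw [integral_cond_Icc, intervalIntegral.integral_const_mul, intervalIntegral.integral_add
    (Continuous.intervalIntegrable (by fun_prop) _ _)
    (Continuous.intervalIntegrable (by fun_prop) _ _), integral_cos_int_mul_pi,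
    integral_cos_int_mul_pi]
  have h2 : √2 * √2 = (2 : ℝ) := Real.mul_self_sqrt zero_le_two
  rcases eq_or_ne a b with rfl | hab
  · rcases eq_or_ne a 0 with rfl | ha
    · norm_num
    · have : (a : ℤ) + a ≠ 0 := by omega
      simp [ha, this, h2]
  · have h3 : (a : ℤ) - b ≠ 0 := by omega
    have h4 : (a : ℤ) + b ≠ 0 := by omega
    rw [if_neg h3, if_neg h4, if_neg hab]
    simp

section Orthonormal

variable {q p k : ℕ}

/-- The frequency with which an admissible set of pairs uses the covariate `j`. -/
def mode (A : Finset (Fin q × Fin p)) (j : Fin p) : ℕ :=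
  ∑ a ∈ A with a.2 = j, ((a.1 : ℕ) + 1)

theorem Admissible.filter_eq_singleton {A : Finset (Fin q × Fin p)} (hA : Admissible k A)
    {i : Fin q} {j : Fin p} (h : (i, j) ∈ A) : A.filter (fun a => a.2 = j) = {(i, j)} := by
  ext ⟨i', j'⟩
  simp only [Finset.mem_filter, Finset.mem_singleton, Prod.mk.injEq]
  constructor
  · rintro ⟨h', rfl⟩
    refine ⟨?_, rfl⟩
    by_contra hne
    exact hA.2 _ h i' hne h'
  · rintro ⟨rfl, rfl⟩
    exact ⟨h, rfl⟩

theorem filter_snd_eq_empty {A : Finset (Fin q × Fin p)} {j : Fin p}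
    (h : ∀ i, (i, j) ∉ A) : A.filter (fun a => a.2 = j) = ∅ := by
  refine Finset.filter_eq_empty_iff.2 ?_
  rintro ⟨i, j'⟩ hm rfl
  exact h i hm

/-- Labels start at 1, so frequency 0 is free to mark an unused covariate, and the frequencies
determine the set. -/
theorem Admissible.mem_iff_mode {A : Finset (Fin q × Fin p)} (hA : Admissible k A)
    (i : Fin q) (j : Fin p) : (i, j) ∈ A ↔ mode A j = i + 1 := by
  by_cases h : ∃ i', (i', j) ∈ A
  · obtain ⟨i', h'⟩ := h
    rw [mode, hA.filter_eq_singleton h', Finset.sum_singleton]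
    constructor
    · intro hi
      by_contra hne
      exact hA.2 _ h' i (by rintro rfl; exact hne rfl) hi
    · intro hi
      rwa [← Fin.ext (Nat.succ_injective hi)]
  · rw [not_exists] at h
    rw [mode, filter_snd_eq_empty h, Finset.sum_empty]
    exact iff_of_false (h i) (by omega)

theorem Admissible.mode_ne {A B : Finset (Fin q × Fin p)} (hA : Admissible k A)
    (hB : Admissible k B) (hAB : A ≠ B) : ∃ j, mode A j ≠ mode B j := by
  by_contra! h
  refine hAB (Finset.ext fun ⟨i, j⟩ => ?_)
  rw [hA.mem_iff_mode, hB.mem_iff_mode, h]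

/-- Admissibility leaves at most one pair over each covariate; an unused covariate contributes the
constant basis element. The full product over j is what lets Fubini factor the inner products. -/
theorem Admissible.prodFn_eq {A : Finset (Fin q × Fin p)} (hA : Admissible k A)
    (x : Fin p → ℝ) : prodFn A x = ∏ j, cosBasis (mode A j) (x j) := by
  rw [prodFn, ← Finset.prod_fiberwise A (fun a => a.2)]
  refine Finset.prod_congr rfl fun j _ => ?_
  by_cases h : ∃ i, (i, j) ∈ A
  · obtain ⟨i, h⟩ := h
    rw [mode, hA.filter_eq_singleton h, Finset.prod_singleton, Finset.sum_singleton, cosBasis,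
      if_neg (Nat.succ_ne_zero _)]
  · rw [not_exists] at h
    rw [mode, filter_snd_eq_empty h]
    simp [cosBasis]

/-- The functions of the ensemble are orthonormal. -/
theorem Admissible.integral_prodFn_mul {A B : Finset (Fin q × Fin p)} (hA : Admissible k A)
    (hB : Admissible k B) :
    ∫ x, prodFn A x * prodFn B x ∂(unifCube p) = if A = B then 1 else 0 := by
  simp_rw [hA.prodFn_eq, hB.prodFn_eq, ← Finset.prod_mul_distrib]
  have : IsProbabilityMeasure (cond (volume : Measure ℝ) (Set.Icc (-1) 1)) :=
    cond_isProbabilityMeasure_of_finite (by simp) (by simp)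
  rw [unifCube, integral_fintype_prod_eq_prod
    (fun j z => cosBasis (mode A j) z * cosBasis (mode B j) z)]
  simp_rw [integral_cosBasis_mul]
  split_ifs with h
  · simp [h]
  · obtain ⟨j, hj⟩ := hA.mode_ne hB h
    exact Finset.prod_eq_zero (Finset.mem_univ j) (if_neg hj)

theorem Admissible.prodFn_injective {A B : Finset (Fin q × Fin p)} (hA : Admissible k A)
    (hB : Admissible k B) (h : prodFn A = prodFn B) : A = B := by
  by_contra hAB
  have h1 := hA.integral_prodFn_mul hA
  have h2 := hA.integral_prodFn_mul hB
  rw [if_pos rfl] at h1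
  rw [if_neg hAB, ← h, h1] at h2
  exact one_ne_zero h2

theorem measurable_prodFn (A : Finset (Fin q × Fin p)) : Measurable (prodFn A) := by
  unfold prodFn basisFn
  fun_prop

theorem abs_prodFn_le (A : Finset (Fin q × Fin p)) (x : Fin p → ℝ) :
    |prodFn A x| ≤ √2 ^ A.card := by
  rw [prodFn, Finset.abs_prod]
  refine (Finset.prod_le_prod (fun _ _ => abs_nonneg _) fun a _ => ?_).trans_eq
    (Finset.prod_const _)
  rw [basisFn, abs_mul, abs_of_nonneg (Real.sqrt_nonneg 2)]
  exact mul_le_of_le_one_right (Real.sqrt_nonneg 2) (Real.abs_cos_le_one _)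

theorem memLp_prodFn (A : Finset (Fin q × Fin p)) : MemLp (prodFn A) 2 (unifCube p) :=
  MemLp.of_bound (measurable_prodFn A).aestronglyMeasurable _ (ae_of_all _ (abs_prodFn_le A))

theorem Ensemble.measurable_fn (g : Ensemble q p k) : Measurable g.fn := by
  obtain ⟨g, A, -, rfl⟩ := g
  exact measurable_prodFn A

theorem Ensemble.memLp_fn (g : Ensemble q p k) : MemLp g.fn 2 (unifCube p) := by
  obtain ⟨g, A, -, rfl⟩ := g
  exact memLp_prodFn A

open Classical in
theorem Ensemble.integral_mul_fn (g h : Ensemble q p k) :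
    ∫ x, g.fn x * h.fn x ∂(unifCube p) = if g = h then 1 else 0 := by
  obtain ⟨A, hA, hgA⟩ := g.2
  obtain ⟨B, hB, hhB⟩ := h.2
  have hiff : g = h ↔ A = B := by
    refine ⟨fun e => hA.prodFn_injective hB ?_, fun e => Subtype.ext ?_⟩
    · rw [← hgA, ← hhB, e]
    · rw [hgA, hhB, e]
  simp only [Ensemble.fn, hgA, hhB, hA.integral_prodFn_mul hB, hiff]

open Classical in
theorem Ensemble.integral_sub_sq (g h : Ensemble q p k) :
    ∫ x, (g.fn x - h.fn x) ^ 2 ∂(unifCube p) = if g = h then 0 else 2 := by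
  have e : ∀ x, (g.fn x - h.fn x) ^ 2
      = g.fn x * g.fn x + h.fn x * h.fn x - 2 * (g.fn x * h.fn x) := fun x => by ring
  have i1 : Integrable (fun x => g.fn x * g.fn x) (unifCube p) :=
    g.memLp_fn.integrable_mul g.memLp_fn
  have i2 : Integrable (fun x => h.fn x * h.fn x) (unifCube p) :=
    h.memLp_fn.integrable_mul h.memLp_fn
  have i3 : Integrable (fun x => g.fn x * h.fn x) (unifCube p) :=
    g.memLp_fn.integrable_mul h.memLp_fn
  simp_rw [e]
  rw [integral_sub (by exact i1.add i2) (i3.const_mul 2), integral_add i1 i2, integral_const_mul,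
    integral_mul_fn, integral_mul_fn, integral_mul_fn]
  split_ifs <;> norm_num at *

/-! ### Risk and log-likelihood integrals -/

section Noise

variable {σ : ℝ≥0} {f : (Fin p → ℝ) → ℝ}

theorem integrable_noise_mul (hf : MemLp f 2 (unifCube p)) :
    Integrable (fun w : (Fin p → ℝ) × ℝ => w.2 * f w.1) (covariateNoise p σ) := by
  have h := (hf.integrable one_le_two).mul_prod
    ((memLp_id_gaussianReal (μ := 0) (v := σ ^ 2) 1).integrable le_rfl)
  exact h.congr (ae_of_all _ fun w => mul_comm _ _)

theorem integral_noise_mul :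
    ∫ w, w.2 * f w.1 ∂(covariateNoise p σ) = 0 := by
  simp_rw [mul_comm _ (f _)]
  rw [covariateNoise, integral_prod_mul f fun e => e, integral_id_gaussianReal, mul_zero]

theorem integrable_sq_fst (hf : MemLp f 2 (unifCube p)) :
    Integrable (fun w : (Fin p → ℝ) × ℝ => f w.1 ^ 2) (covariateNoise p σ) :=
  hf.integrable_sq.comp_fst _

theorem integral_sq_fst :
    ∫ w, f w.1 ^ 2 ∂(covariateNoise p σ) = ∫ x, f x ^ 2 ∂(unifCube p) := by
  rw [covariateNoise, integral_fun_fst (fun x => f x ^ 2)]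
  simp

theorem integrable_sq_noise :
    Integrable (fun w : (Fin p → ℝ) × ℝ => w.2 ^ 2) (covariateNoise p σ) :=
  ((memLp_id_gaussianReal (μ := 0) (v := σ ^ 2) 2).integrable_sq).comp_snd _

theorem integrable_logRatio (hf : MemLp f 2 (unifCube p)) :
    Integrable (logRatio σ f) (covariateNoise p σ) :=
  ((integrable_noise_mul hf).add ((integrable_sq_fst hf).div_const 2)).div_const _

theorem integral_logRatio (hf : MemLp f 2 (unifCube p)) :
    ∫ w, logRatio σ f w ∂(covariateNoise p σ)
      = (∫ x, f x ^ 2 ∂(unifCube p)) / 2 / (σ : ℝ) ^ 2 := by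
  unfold logRatio
  rw [integral_div, integral_add (integrable_noise_mul hf) ((integrable_sq_fst hf).div_const 2),
    integral_noise_mul, integral_div, integral_sq_fst]
  simp

theorem loss_comp_observe (g gbar : (Fin p → ℝ) → ℝ) (w : (Fin p → ℝ) × ℝ) :
    loss g (observe gbar w)
      = (gbar w.1 - g w.1) ^ 2 / 2 + w.2 * (gbar w.1 - g w.1) + w.2 ^ 2 / 2 := by
  simp only [loss, observe]
  ring

theorem measurable_loss {g : (Fin p → ℝ) → ℝ} (hg : Measurable g) : Measurable (loss g) := by
  unfold loss
  fun_prop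

variable {g gbar : (Fin p → ℝ) → ℝ}

theorem integrable_loss (hgm : Measurable g) (hbm : Measurable gbar)
    (hg : MemLp g 2 (unifCube p)) (hb : MemLp gbar 2 (unifCube p)) :
    Integrable (loss g) (dataLaw σ gbar) := by
  rw [dataLaw, integrable_map_measure (measurable_loss hgm).aestronglyMeasurable
    (measurable_observe hbm).aemeasurable]
  have hd : MemLp (fun x => gbar x - g x) 2 (unifCube p) := hb.sub hg
  refine ((((integrable_sq_fst hd).div_const 2).add (integrable_noise_mul hd)).add
    (integrable_sq_noise.div_const 2)).congr (ae_of_all _ fun w => ?_)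
  exact (loss_comp_observe g gbar w).symm

/-- The cross term vanishes because the noise is centred and independent of x; the noise variance is
common to all predictors and cancels in the excess risk. -/
theorem risk_eq (hgm : Measurable g) (hbm : Measurable gbar)
    (hg : MemLp g 2 (unifCube p)) (hb : MemLp gbar 2 (unifCube p)) :
    risk σ gbar g = (∫ x, (gbar x - g x) ^ 2 ∂(unifCube p)) / 2
      + (∫ w, w.2 ^ 2 ∂(covariateNoise p σ)) / 2 := by
  have hd : MemLp (fun x => gbar x - g x) 2 (unifCube p) := hb.sub hg
  have i1 := (integrable_sq_fst (σ := σ) hd).div_const 2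
  have i2 := integrable_noise_mul (σ := σ) hd
  rw [risk, dataLaw, integral_map (measurable_observe hbm).aemeasurable
    (measurable_loss hgm).aestronglyMeasurable]
  simp_rw [loss_comp_observe]
  rw [integral_add (by exact i1.add i2) (integrable_sq_noise.div_const 2), integral_add i1 i2,
    integral_noise_mul (f := fun x => gbar x - g x), integral_div, integral_div,
    integral_sq_fst (f := fun x => gbar x - g x), add_zero]

end Noise

open Classical in
/-- Every wrong member of the ensemble has excess risk exactly one. -/
theorem Ensemble.risk_sub_risk (σ : ℝ≥0) (gbar g : Ensemble q p k) :
    risk σ gbar.fn g.fn - risk σ gbar.fn gbar.fn = if gbar = g then 0 else 1 := by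
  rw [risk_eq g.measurable_fn gbar.measurable_fn g.memLp_fn gbar.memLp_fn,
    risk_eq gbar.measurable_fn gbar.measurable_fn gbar.memLp_fn gbar.memLp_fn,
    integral_sub_sq, integral_sub_sq]
  split_ifs <;> norm_num at *

end Orthonormal

/-! ### Counting the ensemble -/

/-- The set of pairs `(f j, j)`, for `j` in `s`. -/
def graphOn {q p : ℕ} (s : Finset (Fin p)) (f : ∀ j ∈ s, Fin q) : Finset (Fin q × Fin p) :=
  s.attach.image fun j : {j // j ∈ s} => (f j j.2, (j : Fin p))

theorem mem_graphOn {q p : ℕ} {s : Finset (Fin p)} {f : ∀ j ∈ s, Fin q} {a : Fin q × Fin p} :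
    a ∈ graphOn s f ↔ ∃ h : a.2 ∈ s, f a.2 h = a.1 := by
  obtain ⟨i, j⟩ := a
  simp only [graphOn, Finset.mem_image, Finset.mem_attach, true_and, Subtype.exists,
    Prod.mk.injEq]
  constructor
  · rintro ⟨j', h, h1, rfl⟩
    exact ⟨h, h1⟩
  · rintro ⟨h, h1⟩
    exact ⟨j, h, h1, rfl⟩

theorem card_graphOn_le {q p : ℕ} (s : Finset (Fin p)) (f : ∀ j ∈ s, Fin q) :
    (graphOn s f).card ≤ s.card :=
  Finset.card_image_le.trans_eq s.card_attach

theorem graphOn_injective {q p : ℕ} : Function.Injective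
    fun F : (s : Finset (Fin p)) × (∀ j ∈ s, Fin q) => graphOn F.1 F.2 := by
  rintro ⟨s, f⟩ ⟨t, g⟩ h
  have hst : s = t := by
    ext j
    constructor
    · intro hj
      have : (f j hj, j) ∈ graphOn s f := mem_graphOn.2 ⟨hj, rfl⟩
      rw [show graphOn s f = graphOn t g from h] at this
      exact (mem_graphOn.1 this).1
    · intro hj
      have : (g j hj, j) ∈ graphOn t g := mem_graphOn.2 ⟨hj, rfl⟩
      rw [← show graphOn s f = graphOn t g from h] at this
      exact (mem_graphOn.1 this).1
  subst hst
  congr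
  funext j hj
  have : (f j hj, j) ∈ graphOn s f := mem_graphOn.2 ⟨hj, rfl⟩
  rw [show graphOn s f = graphOn s g from h] at this
  exact (mem_graphOn.1 this).2.symm

theorem admissible_graphOn {q p k : ℕ} {s : Finset (Fin p)} (hs : s.card ≤ k + 1)
    (f : ∀ j ∈ s, Fin q) : Admissible k (graphOn s f) := by
  refine ⟨(card_graphOn_le s f).trans hs, fun a ha l hl hla => hl ?_⟩
  obtain ⟨_, h1⟩ := mem_graphOn.1 ha
  obtain ⟨_, h2⟩ := mem_graphOn.1 hla
  exact h2.symm.trans h1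

/-- There are at least `q ^ (k + 1) * p.choose (k + 1)` admissible sets of pairs. -/
theorem le_card_admissible (q p k : ℕ) :
    q ^ (k + 1) * p.choose (k + 1)
      ≤ Nat.card {A : Finset (Fin q × Fin p) // Admissible k A} := by
  classical
  -- Sets of exactly k + 1 covariates, each covariate given a free label, already suffice.
  let X := (Finset.powersetCard (k + 1) (Finset.univ : Finset (Fin p))).sigma
    fun s => s.pi fun _ => (Finset.univ : Finset (Fin q))
  have hX : X.card = q ^ (k + 1) * p.choose (k + 1) := by
    rw [Finset.card_sigma, Finset.sum_congr rfl (g := fun _ => q ^ (k + 1)), Finset.sum_const]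
    · simp [mul_comm]
    · intro s hs
      rw [Finset.card_pi]
      simp [(Finset.mem_powersetCard.1 hs).2]
  rw [← hX, ← Nat.card_eq_finsetCard X]
  refine Nat.card_le_card_of_injective (fun F : X => ⟨graphOn F.1.1 F.1.2, ?_⟩) ?_
  · have h := (Finset.mem_sigma.1 F.2).1
    exact admissible_graphOn (Finset.mem_powersetCard.1 h).2.le _
  · intro F G h
    exact Subtype.ext (graphOn_injective (Subtype.ext_iff.1 h))

theorem le_card_ensemble (q p k : ℕ) :
    q ^ (k + 1) * p.choose (k + 1) ≤ Fintype.card (Ensemble q p k) := by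
  refine (le_card_admissible q p k).trans ?_
  rw [← Nat.card_eq_fintype_card]
  refine Nat.card_le_card_of_injective
    (fun A => (⟨prodFn A.1, A.1, A.2, rfl⟩ : Ensemble q p k)) fun A B h => ?_
  exact Subtype.ext (A.2.prodFn_injective B.2 (congrArg Ensemble.fn h))

/-! ### The experiment: sample divergence and averaging over the true function -/

instance (q p k : ℕ) : DiscreteMeasurableSpace (Ensemble q p k) := ⟨fun _ => trivial⟩

/-- A sum of identically distributed terms over a sample, in the presence of a seed. -/
theorem integrable_sum_sample {ι α U : Type*} [Fintype ι] [MeasurableSpace α]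
    [MeasurableSpace U] {μ : Measure α} [IsProbabilityMeasure μ] (ν : Measure U)
    [IsProbabilityMeasure ν] {f : α → ℝ} (hf : Integrable f μ) :
    Integrable (fun w : (ι → α) × U => ∑ i, f (w.1 i)) ((Measure.pi fun _ => μ).prod ν) :=
  integrable_finsetSum _ fun i _ =>
    (integrable_comp_eval (μ := fun _ : ι => μ) (i := i) hf).comp_fst ν

theorem integral_sum_sample {ι α U : Type*} [Fintype ι] [MeasurableSpace α]
    [MeasurableSpace U] {μ : Measure α} [IsProbabilityMeasure μ] (ν : Measure U)
    [IsProbabilityMeasure ν] {f : α → ℝ} (hf : Integrable f μ) :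
    ∫ w : (ι → α) × U, ∑ i, f (w.1 i) ∂((Measure.pi fun _ => μ).prod ν)
      = Fintype.card ι * ∫ a, f a ∂μ := by
  rw [integral_fun_fst (fun w : ι → α => ∑ i, f (w i)),
    integral_finsetSum _ fun i _ => integrable_comp_eval (μ := fun _ : ι => μ) (i := i) hf]
  simp_rw [fun i : ι => integral_comp_eval (μ := fun _ : ι => μ) (i := i)
    hf.aestronglyMeasurable]
  simp

section Experiment

variable {q p k n : ℕ} {σ : ℝ≥0} {U : Type*} [MeasurableSpace U] (ν : Measure U)
  [IsProbabilityMeasure ν]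

/-- The divergence of the law of a sample from that of pure noise is `n / (2 σ²)`. -/
theorem integral_sum_logRatio (g : Ensemble q p k) :
    ∫ w : (Fin n → (Fin p → ℝ) × ℝ) × U, ∑ i, logRatio σ g.fn (w.1 i)
      ∂((Measure.pi fun _ => covariateNoise p σ).prod ν) = n / (2 * (σ : ℝ) ^ 2) := by
  have hsq : ∫ x, g.fn x ^ 2 ∂(unifCube p) = 1 := by
    simpa [sq] using g.integral_mul_fn g
  rw [integral_sum_sample ν (integrable_logRatio g.memLp_fn), integral_logRatio g.memLp_fn, hsq,
    Fintype.card_fin]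
  ring

/-- Fano's inequality for the recovery of the true function. -/
theorem sum_recovery_mul_log_card_le (hσ : 0 < σ)
    {est : (Fin n → (Fin p → ℝ) × ℝ) × U → Ensemble q p k} (hest : Measurable est) :
    (∑ g : Ensemble q p k, ((Measure.pi fun _ => covariateNoise p σ).prod ν).real
        {w | est (sample g.fn w.1, w.2) = g}) * Real.log (Fintype.card (Ensemble q p k) : ℝ)
      ≤ (Fintype.card (Ensemble q p k) : ℝ) * (n / (2 * (σ : ℝ) ^ 2) + Real.log 2) := by
  refine sum_measureReal_mul_log_card_le
    (T := fun (g : Ensemble q p k) (w : (Fin n → (Fin p → ℝ) × ℝ) × U) => (sample g.fn w.1, w.2))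
    (l := fun g w => ∑ i, logRatio σ g.fn (w.1 i))
    (Q := (Measure.pi fun _ => covariateNoise p σ).prod ν)
    (fun g => ?_) (fun g => ?_) (fun g => integrable_sum_sample ν (integrable_logRatio g.memLp_fn))
    (fun g => (integral_sum_logRatio ν g).le)
    (fun g => measurePreserving_sample n hσ g.measurable_fn ν) hest
  · exact ((measurable_sample g.measurable_fn).comp measurable_fst).prodMk measurable_snd
  · have := measurable_logRatio σ g.measurable_fn
    fun_prop

/-- The probability of an event of the experiment, as an average over the true function. -/
theorem experiment_apply {S : Set (Ensemble q p k × (Fin n → (Fin p → ℝ) × ℝ) × U)}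
    (hS : ∀ g, MeasurableSet {w | (g, w) ∈ S}) :
    experiment q p k n σ ν S = ENNReal.ofReal ((∑ g : Ensemble q p k,
      ((Measure.pi fun _ => covariateNoise p σ).prod ν).real {w | (g, w) ∈ S})
        / Fintype.card (Ensemble q p k)) := by
  have hmeas : MeasurableSet S := by
    have h : Measurable fun z => z ∈ S :=
      measurable_from_prod_countable_right fun g => measurable_mem.2 (hS g)
    exact measurable_mem.1 h
  rw [experiment, Measure.prod_apply hmeas, lintegral_fintype, Finset.sum_div,
    ENNReal.ofReal_sum_of_nonneg fun _ _ => by positivity]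
  refine Finset.sum_congr rfl fun g _ => ?_
  rw [PMF.toMeasure_apply_singleton _ _ (measurableSet_singleton g), div_eq_mul_inv,
    ENNReal.ofReal_mul measureReal_nonneg, ofReal_measureReal, PMF.uniformOfFintype_apply,
    ENNReal.ofReal_inv_of_pos (Nat.cast_pos.2 Fintype.card_pos), ENNReal.ofReal_natCast]
  rfl

end Experiment

end TreeEnsemble

end

/-! ### The lower bound -/

theorem corollary2 (q p k n : ℕ) (σ : ℝ≥0) (hσ : 0 < σ)
    (hn : (n : ℝ) ≤
      (Real.log ((q : ℝ) ^ (k + 1) * (p.choose (k + 1) : ℝ)) - 2 * Real.log 2) * (σ : ℝ) ^ 2 / 2)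
    {U : Type*} [MeasurableSpace U] (ν : Measure U) [IsProbabilityMeasure ν]
    (est : (Fin n → (Fin p → ℝ) × ℝ) × U → TreeEnsemble.Ensemble q p k)
    (hest : Measurable est) :
    (∀ gbar g : TreeEnsemble.Ensemble q p k,
      Integrable (TreeEnsemble.loss g.fn) (TreeEnsemble.dataLaw σ gbar.fn)) ∧
    (1 / 2 : ℝ≥0∞) ≤ TreeEnsemble.experiment q p k n σ ν
      {w | 1 ≤ TreeEnsemble.risk σ w.1.fn (est (TreeEnsemble.sample w.1.fn w.2.1, w.2.2)).fn
              - TreeEnsemble.risk σ w.1.fn w.1.fn} := by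
  refine ⟨fun gbar g => TreeEnsemble.integrable_loss g.measurable_fn gbar.measurable_fn
    g.memLp_fn gbar.memLp_fn, ?_⟩
  -- The excess risk takes only the values 0 and 1, so it is at least 1 exactly when the estimate is
  -- wrong.
  have hset : {w : TreeEnsemble.Ensemble q p k × (Fin n → (Fin p → ℝ) × ℝ) × U |
      1 ≤ TreeEnsemble.risk σ w.1.fn (est (TreeEnsemble.sample w.1.fn w.2.1, w.2.2)).fn
        - TreeEnsemble.risk σ w.1.fn w.1.fn}
      = {w | est (TreeEnsemble.sample w.1.fn w.2.1, w.2.2) ≠ w.1} := by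
    ext w
    simp only [Set.mem_ofPred_eq, TreeEnsemble.Ensemble.risk_sub_risk]
    split_ifs with h
    · simp [← h]
    · simp [Ne.symm h]
  have hm : ∀ g : TreeEnsemble.Ensemble q p k, MeasurableSet
      {w : (Fin n → (Fin p → ℝ) × ℝ) × U | est (TreeEnsemble.sample g.fn w.1, w.2) = g} :=
    fun g => (hest.comp (((TreeEnsemble.measurable_sample g.measurable_fn).comp
      measurable_fst).prodMk measurable_snd)) (measurableSet_singleton g)
  rw [hset, TreeEnsemble.experiment_apply ν fun g => (hm g).compl]
  have hfano := TreeEnsemble.sum_recovery_mul_log_card_le ν hσ hest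
  set R : TreeEnsemble.Ensemble q p k → ℝ := fun g =>
    ((Measure.pi fun _ => TreeEnsemble.covariateNoise p σ).prod ν).real
      {w | est (TreeEnsemble.sample g.fn w.1, w.2) = g} with hR
  have herr : ∀ g : TreeEnsemble.Ensemble q p k,
      ((Measure.pi fun _ => TreeEnsemble.covariateNoise p σ).prod ν).real
        {w | (g, w) ∈ {w : TreeEnsemble.Ensemble q p k × (Fin n → (Fin p → ℝ) × ℝ) × U |
          est (TreeEnsemble.sample w.1.fn w.2.1, w.2.2) ≠ w.1}} = 1 - R g :=
    fun g => probReal_compl_eq_one_sub (hm g)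
  simp_rw [herr]
  set N : ℝ := (Fintype.card (TreeEnsemble.Ensemble q p k) : ℝ) with hN
  have hN0 : 0 < N := Nat.cast_pos.2 Fintype.card_pos
  have hMN : (q : ℝ) ^ (k + 1) * (p.choose (k + 1) : ℝ) ≤ N := by
    rw [hN]
    exact_mod_cast TreeEnsemble.le_card_ensemble q p k
  set M : ℝ := (q : ℝ) ^ (k + 1) * (p.choose (k + 1) : ℝ) with hM
  have hσ2 : 0 < (σ : ℝ) ^ 2 := by positivity
  have hn' : n / (2 * (σ : ℝ) ^ 2) ≤ (Real.log M - 2 * Real.log 2) / 4 := by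
    rw [div_le_div_iff₀ (by positivity) (by norm_num)]
    linarith
  have hlog2 : 0 < Real.log 2 := Real.log_pos one_lt_two
  have hlogM : 2 * Real.log 2 ≤ Real.log M := by
    have : 0 ≤ n / (2 * (σ : ℝ) ^ 2) := by positivity
    linarith
  -- Although `Real.log 0 = 0`, the case M = 0 is excluded as under log 0 = -∞: the bound on n would
  -- be negative.
  have hM0 : 0 < M := by
    refine lt_of_le_of_ne (by positivity) fun h => ?_
    rw [← h, Real.log_zero] at hlogM
    linarith
  have hlogN : Real.log M ≤ Real.log N := Real.log_le_log hM0 hMN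
  have hs : ∑ g, R g ≤ N / 2 := by
    -- (log M - 2 log 2) / 4 + log 2 = log M / 4 + log 2 / 2 ≤ log M / 2, since log M ≥ 2 log 2.
    have h1 : (∑ g, R g) * Real.log N ≤ N / 2 * Real.log N := by
      refine hfano.trans ?_
      rw [div_mul_eq_mul_div, mul_div_assoc]
      exact mul_le_mul_of_nonneg_left (by linarith) hN0.le
    exact le_of_mul_le_mul_right h1 (by linarith)
  rw [show (1 / 2 : ℝ≥0∞) = ENNReal.ofReal (1 / 2) by
    rw [ENNReal.ofReal_div_of_pos two_pos]; simp]
  refine ENNReal.ofReal_le_ofReal ?_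
  rw [le_div_iff₀ hN0, Finset.sum_sub_distrib]
  simp only [Finset.sum_const, Finset.card_univ, nsmul_eq_mul, mul_one]
  linarith
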